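/- Let $\mathcal L$ be a positive-definite linear functional on complex polynomials, that is, $\mathcal L[p]>0$ for every polynomial $p\not\equiv 0$ with $p(x)\ge 0$ for all $x\in\mathbb R$, and let $\{P_n\}_{n\ge 0}$ be its monic orthogonal polynomial system: $P_n$ is monic of degree $n$, $\mathcal L[P_nP_m]=0$ for $n\neq m$, and $\mathcal L[P_n^2]\neq 0$. Suppose that $\{P_n\}$ is in the Nevai class $\mathcal N(a,c)$ for some $a\in[0,\infty)$ and $c\in\mathbb R$; that is, the coefficients of the three-term recurrence $$zP_n(z)=P_{n+1}(z)+c_{n+1}P_n(z)+\lambda_{n+1}P_{n-1}(z)\quad(n\ge 1),\qquad P_0=1,\quad P_1(z)=z-c_1,$$ satisfy $c_n\to c$ and $\lambda_n\to a$. Let $\kappa\in\mathbb C\setminus\mathbb R$ and let $$P_n^*(\kappa,z)=\frac{1}{z-\kappa}\left[P_{n+1}(z)-\frac{P_{n+1}(\kappa)}{P_n(\kappa)}P_n(z)\right],\qquad n\ge 0,$$ be the corresponding kernel polynomials. Then $$\lim_{n\to\infty}\frac{P^*_{n+1}(\kappa,z)}{P^*_n(\kappa,z)}=\lim_{n\to\infty}\frac{P_{n+1}(z)}{P_n(z)}=f(z):=\frac{(z-c)+\sqrt{(z-c)^2-4a}}{2},$$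 where both limits are uniform on compact subsets of $\mathbb C\setminus\mathbb R$ and the branch of the square root is the one that is holomorphic off the real segment $[c-2\sqrt a,\,c+2\sqrt a]$ and equals $z-c+O(1/z)$ as $z\to\infty$. Here $P_n$ has no zeros in $\mathbb C\setminus\mathbb R$ for any $n$ (so $P_n(\kappa)\ne 0$), and for every compact $K\subset\mathbb C\setminus\mathbb R$ the polynomial $P^*_n(\kappa,\cdot)$ has no zeros in $K$ for all sufficiently large $n$, so that the quotients make sense. -/

import Mathlib

open Polynomial

/-- A complex linear functional `L` on polynomials is positive-definite if `L[p] > 0` (in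
particular `L[p]` is real) for every polynomial `p ≠ 0` with `p(x) ≥ 0` for all real `x`.
The order on `ℂ` is the usual partial one: `0 ≤ w` says that `w` is real and nonnegative. -/
def IsPositiveDefinite (L : ℂ[X] →ₗ[ℂ] ℂ) : Prop :=
  ∀ p : ℂ[X], p ≠ 0 →
    (∀ x : ℝ, 0 ≤ (p.eval (x : ℂ)).re ∧ (p.eval (x : ℂ)).im = 0) →
    0 < (L p).re ∧ (L p).im = 0

/-- `P` is the monic orthogonal polynomial system of the linear functional `L`. -/
structure IsMonicOPS (L : ℂ[X] →ₗ[ℂ] ℂ) (P : ℕ → ℂ[X]) : Prop where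
  monic : ∀ n, (P n).Monic
  natDegree_eq : ∀ n, (P n).natDegree = n
  orthogonal : ∀ m n, m ≠ n → L (P m * P n) = 0
  sq_ne_zero : ∀ n, L (P n ^ 2) ≠ 0

/-- `P` satisfies `P₀ = 1`, `P₁ = z - b₁` and
`z Pₙ = Pₙ₊₁ + bₙ₊₁ Pₙ + lₙ₊₁ Pₙ₋₁` for `n ≥ 1`; the last one is written with `n + 1` for `n`.
(The values `b 0`, `l 0`, `l 1` are not used.) -/
def HasRecurrence (P : ℕ → ℂ[X]) (b l : ℕ → ℂ) : Prop :=
  P 0 = 1 ∧ P 1 = X - C (b 1) ∧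
    ∀ n, X * P (n + 1) = P (n + 2) + C (b (n + 2)) * P (n + 1) + C (l (n + 2)) * P n

/-- The Nevai class `N(a, c)`, with `c` real and `a ≥ 0`: the coefficients of the three-term
recurrence relation of the monic polynomials `P` satisfy `bₙ → c` and `lₙ → a`. -/
def InNevaiClass (P : ℕ → ℂ[X]) (a c : ℝ) : Prop :=
  0 ≤ a ∧ ∃ b l : ℕ → ℂ, HasRecurrence P b l ∧
    Filter.Tendsto b Filter.atTop (nhds (c : ℂ)) ∧ Filter.Tendsto l Filter.atTop (nhds (a : ℂ))

/-- The kernel polynomials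
`Pₙ*(κ, z) = (z - κ)⁻¹ (Pₙ₊₁(z) - (Pₙ₊₁(κ) / Pₙ(κ)) Pₙ(z))`, as polynomials in `z`. -/
noncomputable def kernelPolynomial (P : ℕ → ℂ[X]) (κ : ℂ) (n : ℕ) : ℂ[X] :=
  (P (n + 1) - C ((P (n + 1)).eval κ / (P n).eval κ) * P n) /ₘ (X - C κ)

/-- The division in the definition of the kernel polynomials is exact. -/
theorem X_sub_C_mul_kernelPolynomial (P : ℕ → ℂ[X]) (κ : ℂ) (n : ℕ) (h : (P n).eval κ ≠ 0) :
    (X - C κ) * kernelPolynomial P κ n =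
      P (n + 1) - C ((P (n + 1)).eval κ / (P n).eval κ) * P n := by
  unfold kernelPolynomial
  rw [mul_divByMonic_eq_iff_isRoot]
  simp [h]

/-- The branch of `√((z - c)² - 4a)` that is `z - c + O(1/z)` near infinity, written with the
principal square root as `(z - c) √(1 - 4a / (z - c)²)`. -/
noncomputable def branchSqrt (a c : ℝ) (z : ℂ) : ℂ :=
  (z - c) * (1 - 4 * a / (z - c) ^ 2) ^ (1 / 2 : ℂ)

theorem branchSqrt_sq (a c : ℝ) (z : ℂ) (hz : z ≠ c) :
    branchSqrt a c z ^ 2 = (z - c) ^ 2 - 4 * a := by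
  have h : z - c ≠ 0 := sub_ne_zero.mpr hz
  unfold branchSqrt
  rw [mul_pow, ← Complex.cpow_nat_mul]
  norm_num
  field_simp

/-- The branch is holomorphic off the real segment `[c - 2√a, c + 2√a]`. -/
theorem differentiableAt_branchSqrt (a c : ℝ) (ha : 0 ≤ a) (z : ℂ)
    (hz : z.im ≠ 0 ∨ 4 * a < (z.re - c) ^ 2) :
    DifferentiableAt ℂ (branchSqrt a c) z := by
  have h : z - c ≠ 0 := by
    intro h0
    have h1 := congrArg Complex.re h0
    have h2 := congrArg Complex.im h0
    simp only [Complex.sub_re, Complex.sub_im, Complex.ofReal_re, Complex.ofReal_im,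
      Complex.zero_re, Complex.zero_im, sub_zero] at h1 h2
    rcases hz with hz | hz
    · exact hz h2
    · rw [h1] at hz
      nlinarith
  have hs : (1 - 4 * a / (z - c) ^ 2 : ℂ) ∈ Complex.slitPlane := by
    by_contra hn
    rw [Complex.mem_slitPlane_iff_not_le_zero, not_not, Complex.le_def] at hn
    simp only [Complex.zero_re, Complex.zero_im] at hn
    obtain ⟨hre, him⟩ := hn
    set t : ℝ := (1 - 4 * a / (z - c) ^ 2 : ℂ).re with ht
    have e : (1 - 4 * a / (z - c) ^ 2 : ℂ) = (t : ℂ) := by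
      apply Complex.ext <;> simp [ht, him]
    have e2 : ((1 - t : ℝ) : ℂ) * (z - c) ^ 2 = ((4 * a : ℝ) : ℂ) := by
      push_cast
      rw [← e]
      field_simp
      ring
    have r := congrArg Complex.re e2
    have i := congrArg Complex.im e2
    rw [Complex.re_ofReal_mul, Complex.ofReal_re] at r
    rw [Complex.im_ofReal_mul, Complex.ofReal_im] at i
    simp only [pow_two, Complex.mul_re, Complex.mul_im, Complex.sub_re, Complex.sub_im,
      Complex.ofReal_re, Complex.ofReal_im, sub_zero] at r i
    have i' : (z.re - c) * z.im = 0 := by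
      have h1 : (1 - t) ≠ 0 := by linarith
      have := (mul_eq_zero.mp i).resolve_left h1
      linarith
    rcases mul_eq_zero.mp i' with h0 | h0
    · rw [h0] at r
      have hz' : z.im ≠ 0 := by
        rcases hz with hz | hz
        · exact hz
        · rw [h0] at hz
          nlinarith
      have : 0 < z.im * z.im := mul_self_pos.mpr hz'
      nlinarith
    · rw [h0] at r
      have hz' := hz.resolve_left (not_not.mpr h0)
      nlinarith [sq_nonneg (z.re - c)]
  unfold branchSqrt
  refine DifferentiableAt.mul (by fun_prop) (DifferentiableAt.cpow ?_ (by fun_prop) hs)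
  exact (differentiableAt_const _).sub
    ((differentiableAt_const _).div (by fun_prop) (pow_ne_zero 2 h))

/-- The behaviour near infinity that selects the branch. -/
theorem branchSqrt_isBigO (a c : ℝ) :
    (fun z => branchSqrt a c z - (z - c)) =O[Bornology.cobounded ℂ] (fun z => z⁻¹) := by
  have hinv : Filter.Tendsto (fun z : ℂ => (z - c)⁻¹) (Bornology.cobounded ℂ) (nhds 0) :=
    Filter.tendsto_inv₀_cobounded.comp (tendsto_sub_const_cobounded (c : ℂ))
  have hw : Filter.Tendsto (fun z : ℂ => 4 * (a : ℂ) / (z - c) ^ 2)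
      (Bornology.cobounded ℂ) (nhds 0) := by
    have := (hinv.pow 2).const_mul (4 * (a : ℂ))
    simpa [div_eq_mul_inv] using this
  have hd : DifferentiableAt ℂ (fun w : ℂ => (1 - w) ^ (1 / 2 : ℂ)) 0 :=
    DifferentiableAt.cpow (by fun_prop) (by fun_prop) (by simp)
  have h1 := hd.isBigO_sub.comp_tendsto hw
  have hne : ∀ᶠ z : ℂ in Bornology.cobounded ℂ, z - c ≠ 0 :=
    (tendsto_sub_const_cobounded (c : ℂ)).eventually (Bornology.eventually_ne_cobounded 0)
  have h2 := (Asymptotics.isBigO_refl (fun z : ℂ => z - c) (Bornology.cobounded ℂ)).mul h1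
  have h3 : (fun z : ℂ => (z - c)⁻¹) =O[Bornology.cobounded ℂ] (fun z => z⁻¹) := by
    have h4 : Filter.Tendsto (fun z : ℂ => 1 + c * (z - c)⁻¹) (Bornology.cobounded ℂ)
        (nhds 1) := by
      simpa using (hinv.const_mul (c : ℂ)).const_add 1
    have h5 := (h4.isBigO_one ℂ).mul
      (Asymptotics.isBigO_refl (fun z : ℂ => z⁻¹) (Bornology.cobounded ℂ))
    refine h5.congr' ?_ (by simp)
    filter_upwards [hne, Bornology.eventually_ne_cobounded (0 : ℂ)] with z hz hz0
    field_simp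
    ring
  refine (h2.congr' ?_ ?_).trans (h3.const_mul_left (4 * (a : ℂ)))
  · filter_upwards with z
    simp [branchSqrt, mul_sub]
  · filter_upwards [hne] with z hz
    simp
    field_simp

/-- The function `f(z) = ((z - c) + √((z - c)² - 4a)) / 2`. -/
noncomputable def ratioLimit (a c : ℝ) (z : ℂ) : ℂ :=
  ((z - c) + branchSqrt a c z) / 2

/-!
By orthogonality the recurrence coefficients are quotients `b = L[x Pₙ²] / L[Pₙ²]` and
`l = L[Pₙ₊₁²] / L[Pₙ²]`, so positive-definiteness makes them real and the `l` positive
(`HasRecurrence.hasPositiveRecurrence`). The ratios `rₙ = Pₙ₊₁ / Pₙ` satisfy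
`rₙ₊₁ = z - b - l / rₙ`; hence, for `z` off the real line, `rₙ(z)` lies in the same open half-plane
as `z`, at distance at least `|Im z|` from the real line, and no `Pₙ` vanishes there
(`HasPositiveRecurrence.eval_ne_zero_and_sq_im_le`).

The limiting step `r ↦ z - c - a / r` is a Möbius map with fixed points `f = ratioLimit a c z` and
`g = a / f`, where `|g| < |f|` and `g` lies in the closed half-plane opposite to `z`
(`lt_normSq_ratioLimit_and_im_mul_nonpos`). In the coordinate `u = (r - f) / (r - g)`, whose
denominator is bounded away from `0`, the limiting step is multiplication by `g / f`, and the actual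
steps are perturbations of it that vanish uniformly on compact sets (`mobius_step`). So `uₙ → 0`
and `rₙ → f` uniformly on compact sets, by `tendstoUniformlyOn_zero_of_recurrence`.

For the kernel polynomials, `hₙ(z) = Pₙ*(κ, z) / Pₙ(z)` obeys
`hₙ₊₁(z) = 1 + l hₙ(z) / (rₙ(z) rₙ(κ))`, also at `z = κ`. The factor tends to
`θ(z) = a / (f(z) f(κ))`, of modulus less than `1`, and the same lemma gives `hₙ → 1 / (1 - θ)`
uniformly on compact sets. This limit has no zeros, so `Pₙ*` has none on a given compact set for
large `n`, and `Pₙ₊₁* / Pₙ* = rₙ hₙ₊₁ / hₙ → f`.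
-/

/-! ### Uniform convergence and perturbed linear recurrences -/

theorem tendstoUniformlyOn_const_seq (f : ℂ → ℂ) (K : Set ℂ) :
    TendstoUniformlyOn (fun (_ : ℕ) => f) f Filter.atTop K := fun _ hu =>
  Filter.Eventually.of_forall fun _ _ _ => refl_mem_uniformity hu

theorem TendstoUniformlyOn.mul_of_isCompact {K : Set ℂ} (hK : IsCompact K) {F G : ℕ → ℂ → ℂ}
    {f g : ℂ → ℂ} (hF : TendstoUniformlyOn F f Filter.atTop K)
    (hG : TendstoUniformlyOn G g Filter.atTop K) (hf : ContinuousOn f K) (hg : ContinuousOn g K) :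
    TendstoUniformlyOn (fun n z => F n z * G n z) (fun z => f z * g z) Filter.atTop K :=
  (tendstoLocallyUniformlyOn_iff_tendstoUniformlyOn_of_compact hK).mp
    (hF.tendstoLocallyUniformlyOn.fun_mul₀ hG.tendstoLocallyUniformlyOn hf hg)

theorem TendstoUniformlyOn.div_of_isCompact {K : Set ℂ} (hK : IsCompact K) {F G : ℕ → ℂ → ℂ}
    {f g : ℂ → ℂ} (hF : TendstoUniformlyOn F f Filter.atTop K)
    (hG : TendstoUniformlyOn G g Filter.atTop K) (hf : ContinuousOn f K) (hg : ContinuousOn g K)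
    (hg0 : ∀ z ∈ K, g z ≠ 0) :
    TendstoUniformlyOn (fun n z => F n z / G n z) (fun z => f z / g z) Filter.atTop K :=
  (tendstoLocallyUniformlyOn_iff_tendstoUniformlyOn_of_compact hK).mp
    (hF.tendstoLocallyUniformlyOn.fun_div₀ hG.tendstoLocallyUniformlyOn hf hg hg0)

/-- A continuous function of norm less than `1` on a compact set is bounded by some `q < 1`. -/
theorem exists_norm_le_lt_one {K : Set ℂ} (hK : IsCompact K) {θ : ℂ → ℂ} (hθ : ContinuousOn θ K)
    (h1 : ∀ z ∈ K, ‖θ z‖ < 1) : ∃ q : ℝ, 0 ≤ q ∧ q < 1 ∧ ∀ z ∈ K, ‖θ z‖ ≤ q := by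
  rcases K.eq_empty_or_nonempty with rfl | hne
  · exact ⟨0, le_rfl, one_pos, by simp⟩
  · obtain ⟨w, hw, hmax⟩ := hK.exists_isMaxOn hne hθ.norm
    exact ⟨‖θ w‖, norm_nonneg _, h1 w hw, fun z hz => hmax hz⟩

/-- Solutions of `eₙ₊₁ = θₙ eₙ + ηₙ` tend to `0` uniformly on a compact set when `ηₙ → 0` and the
factors `θₙ` have a limit of norm less than `1`: up to a uniformly small error the recurrence is
eventually a contraction. -/
theorem tendstoUniformlyOn_zero_of_recurrence {K : Set ℂ} (hK : IsCompact K)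
    {e θ η : ℕ → ℂ → ℂ} {θ' : ℂ → ℂ} (he : ∀ n, ContinuousOn (e n) K)
    (hrec : ∀ n, ∀ z ∈ K, e (n + 1) z = θ n z * e n z + η n z)
    (hθ : TendstoUniformlyOn θ θ' Filter.atTop K) (hθc : ContinuousOn θ' K)
    (hθ1 : ∀ z ∈ K, ‖θ' z‖ < 1)
    (hη : TendstoUniformlyOn η (fun _ => 0) Filter.atTop K) :
    TendstoUniformlyOn e (fun _ => 0) Filter.atTop K := by
  obtain ⟨q₀, hq₀, hq₀1, hq₀K⟩ := exists_norm_le_lt_one hK hθc hθ1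
  obtain ⟨q, hq₀q, hq1⟩ := exists_between hq₀1
  have hq : 0 ≤ q := hq₀.trans hq₀q.le
  rw [Metric.tendstoUniformlyOn_iff] at hθ hη ⊢
  intro ε hε
  obtain ⟨N, hN⟩ := Filter.eventually_atTop.mp
    ((hθ (q - q₀) (by linarith)).and (hη ((1 - q) * (ε / 2)) (by nlinarith)))
  obtain ⟨B, hB⟩ := hK.exists_bound_of_continuousOn (he N)
  have key : ∀ k, ∀ z ∈ K, ‖e (N + k) z‖ ≤ q ^ k * B + ε / 2 := by
    intro k
    induction k with
    | zero => intro z hz; simpa using (hB z hz).trans (by linarith)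
    | succ k ih =>
      intro z hz
      obtain ⟨h1, h2⟩ := hN (N + k) (Nat.le_add_right _ _)
      have h1 := h1 z hz
      have h2 := h2 z hz
      rw [dist_comm, dist_eq_norm] at h1
      rw [dist_zero_left] at h2
      have h3 : ‖θ (N + k) z‖ ≤ q := by
        have := norm_le_norm_add_norm_sub' (θ (N + k) z) (θ' z)
        have := hq₀K z hz
        linarith
      rw [← add_assoc, hrec _ z hz]
      calc ‖θ (N + k) z * e (N + k) z + η (N + k) z‖
          ≤ ‖θ (N + k) z‖ * ‖e (N + k) z‖ + ‖η (N + k) z‖ := by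
            rw [← norm_mul]; exact norm_add_le _ _
        _ ≤ q * (q ^ k * B + ε / 2) + (1 - q) * (ε / 2) := by
            gcongr
            exact ih z hz
        _ = q ^ (k + 1) * B + ε / 2 := by ring
  have hlim : Filter.Tendsto (fun k : ℕ => q ^ k * B) Filter.atTop (nhds 0) := by
    simpa using (tendsto_pow_atTop_nhds_zero_of_lt_one hq hq1).mul_const B
  obtain ⟨M, hM⟩ := Filter.eventually_atTop.mp (hlim.eventually_lt_const (half_pos hε))
  filter_upwards [Filter.eventually_ge_atTop (N + M)] with n hn z hz
  obtain ⟨k, rfl⟩ := Nat.exists_eq_add_of_le (show N ≤ n by omega)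
  have h1 := key k z hz
  have h2 := hM k (by omega)
  rw [dist_zero_left]
  linarith

/-! ### The limit function -/

theorem sub_ofReal_ne_zero_of_im_ne_zero {z : ℂ} (hz : z.im ≠ 0) (c : ℝ) : z - c ≠ 0 := by
  intro h
  exact hz (by simpa using congrArg Complex.im h)

theorem ratioLimit_mul_sub_ratioLimit (a c : ℝ) {z : ℂ} (hz : z.im ≠ 0) :
    ratioLimit a c z * (z - c - ratioLimit a c z) = a := by
  have h := branchSqrt_sq a c z (sub_ne_zero.mp (sub_ofReal_ne_zero_of_im_ne_zero hz c))
  unfold ratioLimit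
  linear_combination -h / 4

theorem cpow_half_re_nonneg (w : ℂ) : 0 ≤ (w ^ (1 / 2 : ℂ)).re := by
  rcases eq_or_ne w 0 with rfl | hw
  · simp
  · have him : (Complex.log w * (1 / 2)).im = w.arg / 2 := by
      rw [← Complex.log_im, mul_one_div, Complex.div_ofNat_im]
    rw [Complex.cpow_def_of_ne_zero hw, Complex.exp_re, him]
    refine mul_nonneg (Real.exp_pos _).le (Real.cos_nonneg_of_neg_pi_div_two_le_of_le ?_ ?_)
    · linarith [Complex.neg_pi_lt_arg w]
    · linarith [Complex.arg_le_pi w]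

/-- The chosen branch is the root of larger modulus of `w² - (z - c) w + a`; the roots are
`(z - c) (1 ± t) / 2` with `0 ≤ Re t`. -/
theorem norm_sub_ratioLimit_le (a c : ℝ) (z : ℂ) :
    ‖z - c - ratioLimit a c z‖ ≤ ‖ratioLimit a c z‖ := by
  set t : ℂ := (1 - 4 * a / (z - c) ^ 2 : ℂ) ^ (1 / 2 : ℂ) with ht
  have h0 : 0 ≤ t.re := cpow_half_re_nonneg _
  have h1 : ratioLimit a c z = (z - c) / 2 * (1 + t) := by
    rw [ratioLimit, branchSqrt, ← ht]; ring
  have h2 : z - c - ratioLimit a c z = (z - c) / 2 * (1 - t) := by rw [h1]; ring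
  rw [h2, h1, norm_mul, norm_mul]
  refine mul_le_mul_of_nonneg_left ?_ (norm_nonneg _)
  rw [← sq_le_sq₀ (norm_nonneg _) (norm_nonneg _), Complex.sq_norm, Complex.sq_norm,
    Complex.normSq_apply, Complex.normSq_apply]
  simp
  nlinarith

theorem ratioLimit_ne_zero (a c : ℝ) {z : ℂ} (hz : z.im ≠ 0) : ratioLimit a c z ≠ 0 := by
  intro h
  have h1 := norm_sub_ratioLimit_le a c z
  rw [h, norm_zero, norm_le_zero_iff, sub_zero] at h1
  exact sub_ofReal_ne_zero_of_im_ne_zero hz c h1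

theorem sub_ratioLimit_eq_div (a c : ℝ) {z : ℂ} (hz : z.im ≠ 0) :
    z - c - ratioLimit a c z = a / ratioLimit a c z := by
  rw [eq_div_iff (ratioLimit_ne_zero a c hz), mul_comm, ratioLimit_mul_sub_ratioLimit a c hz]

/-- Off the real line `f(z)` dominates strictly the other root `g = a / f`, and `g` lies in the
closed half-plane opposite to `z`. Taking imaginary parts in `g |f|² = a f̄` gives
`Im f (|f|² - a) = Im z |f|²`, and `|f|² ≥ a` because `|g| ≤ |f|`. -/
theorem lt_normSq_ratioLimit_and_im_mul_nonpos {a : ℝ} (ha : 0 ≤ a) (c : ℝ) {z : ℂ}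
    (hz : z.im ≠ 0) : a < ‖ratioLimit a c z‖ ^ 2 ∧
      (z - c - ratioLimit a c z).im * z.im ≤ 0 := by
  have hfg := ratioLimit_mul_sub_ratioLimit a c hz
  have hle := norm_sub_ratioLimit_le a c z
  have hf0 := ratioLimit_ne_zero a c hz
  have hsum : (ratioLimit a c z).im + (z - c - ratioLimit a c z).im = z.im := by simp
  generalize z - c - ratioLimit a c z = g at *
  generalize ratioLimit a c z = f at *
  have hN : 0 < ‖f‖ ^ 2 := by positivity
  have haN : a ≤ ‖f‖ ^ 2 := by
    have h := congrArg norm hfg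
    rw [norm_mul, Complex.norm_real, Real.norm_of_nonneg ha] at h
    nlinarith [norm_nonneg f]
  have hre := congrArg Complex.re hfg
  have him := congrArg Complex.im hfg
  rw [Complex.mul_re, Complex.ofReal_re] at hre
  rw [Complex.mul_im, Complex.ofReal_im] at him
  have hsq : ‖f‖ ^ 2 = f.re * f.re + f.im * f.im := by
    rw [Complex.sq_norm, Complex.normSq_apply]
  have hg : g.im * ‖f‖ ^ 2 = -a * f.im := by
    rw [hsq]; linear_combination f.re * him - f.im * hre
  have hf : f.im * (‖f‖ ^ 2 - a) = z.im * ‖f‖ ^ 2 := by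
    rw [← hsum]; linear_combination -hg
  have hlt : a < ‖f‖ ^ 2 := by
    refine lt_of_le_of_ne haN fun h => ?_
    rw [h, sub_self, mul_zero] at hf
    exact mul_ne_zero hz hN.ne' hf.symm
  refine ⟨hlt, ?_⟩
  have h1 : f.im * z.im * (‖f‖ ^ 2 - a) = z.im ^ 2 * ‖f‖ ^ 2 := by
    linear_combination z.im * hf
  have h2 : 0 ≤ f.im * z.im := by
    by_contra hneg
    have := mul_neg_of_neg_of_pos (not_le.mp hneg) (sub_pos.mpr hlt)
    have : 0 ≤ z.im ^ 2 * ‖f‖ ^ 2 := by positivity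
    linarith
  have h3 : g.im * z.im * ‖f‖ ^ 2 = -(a * (f.im * z.im)) := by linear_combination z.im * hg
  by_contra hneg
  have := mul_pos (not_le.mp hneg) hN
  have := mul_nonneg ha h2
  linarith

theorem continuousOn_ratioLimit {a : ℝ} (ha : 0 ≤ a) (c : ℝ) {K : Set ℂ}
    (hK : K ⊆ {z : ℂ | z.im ≠ 0}) : ContinuousOn (ratioLimit a c) K := by
  intro z hz
  have := (differentiableAt_branchSqrt a c ha z (Or.inl (hK hz))).continuousAt
  unfold ratioLimit
  exact ContinuousAt.continuousWithinAt (by fun_prop)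

/-! ### Reality and positivity of the recurrence coefficients -/

theorem IsPositiveDefinite.map_sq_pos {L : ℂ[X] →ₗ[ℂ] ℂ} (hL : IsPositiveDefinite L)
    {p : ℂ[X]} (hp0 : p ≠ 0) (hp : ∀ x : ℝ, (p.eval (x : ℂ)).im = 0) :
    0 < (L (p ^ 2)).re ∧ (L (p ^ 2)).im = 0 := by
  refine hL (p ^ 2) (pow_ne_zero 2 hp0) fun x => ?_
  rw [eval_pow, pow_two, Complex.mul_re, Complex.mul_im, hp x]
  exact ⟨by nlinarith, by ring⟩

/-- Polynomials that are real on the real line have real image under a positive-definite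
functional, being differences of squares of such polynomials. -/
theorem IsPositiveDefinite.im_map_eq_zero {L : ℂ[X] →ₗ[ℂ] ℂ} (hL : IsPositiveDefinite L)
    {p : ℂ[X]} (hp : ∀ x : ℝ, (p.eval (x : ℂ)).im = 0) : (L p).im = 0 := by
  have hsq : ∀ q : ℂ[X], (∀ x : ℝ, (q.eval (x : ℂ)).im = 0) → (L (q ^ 2)).im = 0 := by
    intro q hq
    rcases eq_or_ne q 0 with rfl | hq0
    · simp
    · exact (hL.map_sq_pos hq0 hq).2
  have h : p = C (1 / 4) * (p + 1) ^ 2 - C (1 / 4) * (p - 1) ^ 2 := by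
    have : (C (1 / 4) : ℂ[X]) * 4 = 1 := by
      rw [← C_ofNat, ← C_mul]; norm_num
    linear_combination -p * this
  have h1 := hsq (p + 1) (by simpa using hp)
  have h2 := hsq (p - 1) (by simpa using hp)
  rw [h, map_sub, ← smul_eq_C_mul, ← smul_eq_C_mul, map_smul, map_smul]
  simp [Complex.mul_im, h1, h2]

theorem im_eq_zero_of_mul_eq {b w v : ℂ} (h : b * w = v) (hw : 0 < w.re ∧ w.im = 0)
    (hv : v.im = 0) : b.im = 0 ∧ b.re * w.re = v.re := by
  have h1 := congrArg Complex.im h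
  have h2 := congrArg Complex.re h
  simp only [Complex.mul_im, Complex.mul_re, hw.2, hv, mul_zero, zero_add, sub_zero] at h1 h2
  exact ⟨(mul_eq_zero.mp h1).resolve_right hw.1.ne', h2⟩

section Coefficients

variable {L : ℂ[X] →ₗ[ℂ] ℂ} {P : ℕ → ℂ[X]} {b l : ℕ → ℂ}

theorem map_X_mul_sq (hP : IsMonicOPS L P) (hR : HasRecurrence P b l) (n : ℕ) :
    b (n + 1) * L (P n ^ 2) = L (X * P n ^ 2) := by
  rcases n with _ | n
  · have h2 : X * P 0 ^ 2 = P 0 * P 1 + C (b 1) * P 0 ^ 2 := by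
      rw [hR.1, hR.2.1]; ring
    rw [h2, map_add, hP.orthogonal 0 1 (by norm_num), ← smul_eq_C_mul, map_smul]
    simp
  · have h2 : X * P (n + 1) ^ 2 =
        P (n + 1) * P (n + 2) + C (b (n + 2)) * P (n + 1) ^ 2
          + C (l (n + 2)) * (P (n + 1) * P n) := by
      linear_combination P (n + 1) * hR.2.2 n
    rw [h2, map_add, map_add, hP.orthogonal _ _ (by omega), ← smul_eq_C_mul, ← smul_eq_C_mul,
      map_smul, map_smul, hP.orthogonal _ _ (by omega)]
    simp

theorem map_X_mul_mul_succ (hP : IsMonicOPS L P) (hR : HasRecurrence P b l) (n : ℕ) :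
    L (X * P n * P (n + 1)) = L (P (n + 1) ^ 2) := by
  rcases n with _ | n
  · have h2 : X * P 0 * P 1 = P 1 ^ 2 + C (b 1) * (P 0 * P 1) := by
      rw [hR.1, hR.2.1]; ring
    rw [zero_add, h2, map_add, ← smul_eq_C_mul, map_smul, hP.orthogonal 0 1 (by norm_num)]
    simp
  · have h2 : X * P (n + 1) * P (n + 2) =
        P (n + 2) ^ 2 + C (b (n + 2)) * (P (n + 1) * P (n + 2))
          + C (l (n + 2)) * (P n * P (n + 2)) := by
      linear_combination P (n + 2) * hR.2.2 n
    rw [h2, map_add, map_add, ← smul_eq_C_mul, ← smul_eq_C_mul, map_smul, map_smul,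
      hP.orthogonal _ _ (by omega), hP.orthogonal _ _ (by omega)]
    simp

theorem mul_map_sq (hP : IsMonicOPS L P) (hR : HasRecurrence P b l) (n : ℕ) :
    l (n + 2) * L (P n ^ 2) = L (P (n + 1) ^ 2) := by
  have h2 : X * P n * P (n + 1) =
      P n * P (n + 2) + C (b (n + 2)) * (P n * P (n + 1)) + C (l (n + 2)) * P n ^ 2 := by
    linear_combination P n * hR.2.2 n
  have h3 := map_X_mul_mul_succ hP hR n
  rw [h2, map_add, map_add, ← smul_eq_C_mul, ← smul_eq_C_mul, map_smul, map_smul,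
    hP.orthogonal _ _ (by omega), hP.orthogonal _ _ (by omega)] at h3
  simpa using h3

/-- One step of the induction that proves the `Pₙ` and the coefficients real together. -/
theorem im_coeff_eq_zero (hL : IsPositiveDefinite L) (hP : IsMonicOPS L P)
    (hR : HasRecurrence P b l) {n : ℕ} (hn : ∀ x : ℝ, ((P n).eval (x : ℂ)).im = 0) :
    (b (n + 1)).im = 0 := by
  refine (im_eq_zero_of_mul_eq (map_X_mul_sq hP hR n)
    (hL.map_sq_pos (hP.monic n).ne_zero hn) (hL.im_map_eq_zero fun x => ?_)).1
  simp [pow_two, Complex.mul_im, hn x]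

theorem coeff_pos (hL : IsPositiveDefinite L) (hP : IsMonicOPS L P)
    (hR : HasRecurrence P b l) {n : ℕ} (hn : ∀ x : ℝ, ((P n).eval (x : ℂ)).im = 0)
    (hn1 : ∀ x : ℝ, ((P (n + 1)).eval (x : ℂ)).im = 0) :
    0 < (l (n + 2)).re ∧ (l (n + 2)).im = 0 := by
  have h0 := hL.map_sq_pos (hP.monic n).ne_zero hn
  have h1 := hL.map_sq_pos (hP.monic (n + 1)).ne_zero hn1
  obtain ⟨him, hre⟩ := im_eq_zero_of_mul_eq (mul_map_sq hP hR n) h0 h1.2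
  refine ⟨?_, him⟩
  exact pos_of_mul_pos_left (hre ▸ h1.1) h0.1.le

theorem HasRecurrence.eval_succ_succ (hR : HasRecurrence P b l) (n : ℕ) (z : ℂ) :
    (P (n + 2)).eval z = (z - b (n + 2)) * (P (n + 1)).eval z - l (n + 2) * (P n).eval z := by
  have h := congrArg (eval z) (hR.2.2 n)
  simp only [eval_mul, eval_add, eval_X, eval_C] at h
  linear_combination -h

theorem eval_im_eq_zero (hL : IsPositiveDefinite L) (hP : IsMonicOPS L P)
    (hR : HasRecurrence P b l) (n : ℕ) :
    (∀ x : ℝ, ((P n).eval (x : ℂ)).im = 0) ∧ ∀ x : ℝ, ((P (n + 1)).eval (x : ℂ)).im = 0 := by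
  induction n with
  | zero =>
    have h0 : ∀ x : ℝ, ((P 0).eval (x : ℂ)).im = 0 := by simp [hR.1]
    refine ⟨h0, fun x => ?_⟩
    have := im_coeff_eq_zero hL hP hR h0
    rw [zero_add] at this ⊢
    simp [hR.2.1, this]
  | succ n ih =>
    refine ⟨ih.2, fun x => ?_⟩
    have hb := im_coeff_eq_zero hL hP hR ih.2
    have hl := coeff_pos hL hP hR ih.1 ih.2
    rw [show n + 1 + 1 = n + 2 from rfl] at hb ⊢
    rw [hR.eval_succ_succ]
    simp [Complex.mul_im, hb, hl.2, ih.1 x, ih.2 x]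

end Coefficients

/-- A three-term recurrence as in `HasRecurrence` whose coefficients are real, with positive
`l n`; only the coefficients that occur in the recurrence are constrained. -/
structure HasPositiveRecurrence (P : ℕ → ℂ[X]) (b l : ℕ → ℂ) : Prop where
  hasRecurrence : HasRecurrence P b l
  im_b : ∀ n, (b (n + 1)).im = 0
  re_l : ∀ n, 0 < (l (n + 2)).re
  im_l : ∀ n, (l (n + 2)).im = 0

/-- The easy half of Favard's theorem: positive-definiteness makes the recurrence coefficients real
and the `l n` positive. -/
theorem HasRecurrence.hasPositiveRecurrence {L : ℂ[X] →ₗ[ℂ] ℂ} {P : ℕ → ℂ[X]} {b l : ℕ → ℂ}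
    (hR : HasRecurrence P b l) (hL : IsPositiveDefinite L) (hP : IsMonicOPS L P) :
    HasPositiveRecurrence P b l where
  hasRecurrence := hR
  im_b n := im_coeff_eq_zero hL hP hR (eval_im_eq_zero hL hP hR n).1
  re_l n := (coeff_pos hL hP hR (eval_im_eq_zero hL hP hR n).1 (eval_im_eq_zero hL hP hR n).2).1
  im_l n := (coeff_pos hL hP hR (eval_im_eq_zero hL hP hR n).1 (eval_im_eq_zero hL hP hR n).2).2

/-! ### Ratios of consecutive polynomials -/

/-- The ratio `rₙ(z) = Pₙ₊₁(z) / Pₙ(z)`. -/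
noncomputable def consecutiveRatio (P : ℕ → ℂ[X]) (n : ℕ) (z : ℂ) : ℂ :=
  (P (n + 1)).eval z / (P n).eval z

theorem abs_im_le_norm_of_sq_le {w z : ℂ} (hz : z.im ≠ 0) (h : z.im ^ 2 ≤ w.im * z.im) :
    |z.im| ≤ ‖w‖ := by
  refine le_trans ?_ (Complex.abs_im_le_norm w)
  refine le_of_mul_le_mul_right ?_ (abs_pos.mpr hz)
  rw [← abs_mul, ← abs_mul]
  refine le_trans ?_ (le_abs_self _)
  rwa [← pow_two, abs_of_nonneg (sq_nonneg _)]

section Ratio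

variable {P : ℕ → ℂ[X]} {b l : ℕ → ℂ}

theorem HasRecurrence.consecutiveRatio_succ (hR : HasRecurrence P b l) {n : ℕ} {z : ℂ}
    (h1 : (P (n + 1)).eval z ≠ 0) :
    consecutiveRatio P (n + 1) z = z - b (n + 2) - l (n + 2) / consecutiveRatio P n z := by
  simp only [consecutiveRatio]
  rw [show n + 1 + 1 = n + 2 from rfl, hR.eval_succ_succ]
  field_simp

/-- The Nevanlinna property `Im rₙ(z) ≥ Im z` in the upper half-plane, and its mirror image in the
lower one; it also shows that the next polynomial does not vanish. -/
theorem HasPositiveRecurrence.eval_ne_zero_and_sq_im_le (h : HasPositiveRecurrence P b l) (n : ℕ)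
    {z : ℂ} (hz : z.im ≠ 0) :
    (P n).eval z ≠ 0 ∧ z.im ^ 2 ≤ (consecutiveRatio P n z).im * z.im := by
  induction n with
  | zero =>
    have hb := h.im_b 0
    rw [zero_add] at hb
    simp [consecutiveRatio, h.hasRecurrence.1, h.hasRecurrence.2.1, hb, pow_two]
  | succ n ih =>
    obtain ⟨h0, him⟩ := ih
    have hr : consecutiveRatio P n z ≠ 0 := by
      intro h
      have : 0 < z.im ^ 2 := by positivity
      simp [h] at him
      exact hz him
    have h1 : (P (n + 1)).eval z ≠ 0 := fun h => hr (by simp [consecutiveRatio, h])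
    refine ⟨h1, ?_⟩
    rw [h.hasRecurrence.consecutiveRatio_succ h1]
    set r := consecutiveRatio P n z
    have hb := h.im_b (n + 1)
    rw [show n + 1 + 1 = n + 2 from rfl] at hb
    have e : (z - b (n + 2) - l (n + 2) / r).im =
        z.im + (l (n + 2)).re * r.im / Complex.normSq r := by
      simp [Complex.div_im, hb, h.im_l n]
    rw [e]
    have h2 : 0 ≤ (l (n + 2)).re / Complex.normSq r * (r.im * z.im) :=
      mul_nonneg (div_nonneg (h.re_l n).le (Complex.normSq_nonneg r))
        ((sq_nonneg _).trans him)
    have h3 : (z.im + (l (n + 2)).re * r.im / Complex.normSq r) * z.im =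
        z.im ^ 2 + (l (n + 2)).re / Complex.normSq r * (r.im * z.im) := by ring
    linarith

theorem HasPositiveRecurrence.consecutiveRatio_ne_zero (h : HasPositiveRecurrence P b l) (n : ℕ)
    {z : ℂ} (hz : z.im ≠ 0) : consecutiveRatio P n z ≠ 0 :=
  div_ne_zero (h.eval_ne_zero_and_sq_im_le (n + 1) hz).1 (h.eval_ne_zero_and_sq_im_le n hz).1

theorem HasPositiveRecurrence.continuousOn_consecutiveRatio (h : HasPositiveRecurrence P b l)
    (n : ℕ) {K : Set ℂ} (hK : K ⊆ {z : ℂ | z.im ≠ 0}) :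
    ContinuousOn (consecutiveRatio P n) K :=
  (P (n + 1)).continuous.continuousOn.div (P n).continuous.continuousOn
    fun _ hz => (h.eval_ne_zero_and_sq_im_le n (hK hz)).1

end Ratio

theorem exists_pos_le_abs_im {K : Set ℂ} (hK : IsCompact K) (hK0 : K ⊆ {z : ℂ | z.im ≠ 0}) :
    ∃ m : ℝ, 0 < m ∧ ∀ z ∈ K, m ≤ |z.im| := by
  rcases K.eq_empty_or_nonempty with rfl | hne
  · exact ⟨1, one_pos, by simp⟩
  · obtain ⟨w, hw, hmin⟩ := hK.exists_isMinOn hne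
      (Complex.continuous_im.abs.continuousOn (s := K))
    exact ⟨|w.im|, abs_pos.mpr (hK0 hw), fun z hz => hmin hz⟩

/-- With `f`, `g` the roots of `w² - (z - c) w + a`, the Möbius coordinate
`u = (r - f) / (r - g)` turns the limiting step `r ↦ z - c - a / r` into multiplication by `g / f`,
and `δ` measures the deviation of the actual step from the limiting one. -/
theorem mobius_step {f g r z b l c a r' δ : ℂ} (hf : f ≠ 0) (hr : r ≠ 0) (hrg : r - g ≠ 0)
    (hrg' : r' - g ≠ 0) (hsum : f + g = z - c) (hmul : f * g = a) (hstep : r' = z - b - l / r)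
    (hδ : δ = (c - b + (a - l) / r) / (r' - g)) :
    (r' - f) / (r' - g) = g / f * (1 - δ) * ((r - f) / (r - g)) + δ := by
  have h1 : δ * (r' - g) = c - b + (a - l) / r := by rw [hδ]; field_simp
  have h2 : r' - f = δ * (r' - g) + g * (r - f) / r := by
    rw [h1, hstep, ← hmul]
    field_simp
    linear_combination -r * hsum
  have h3 : (1 - δ) * (r' - g) = f * (r - g) / r := by
    rw [sub_mul, h1, hstep, ← hmul]
    field_simp
    linear_combination -r * hsum
  have h4 : g / f * (1 - δ) * ((r - f) / (r - g)) * (r' - g) = g * (r - f) / r := by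
    have : g / f * (1 - δ) * ((r - f) / (r - g)) * (r' - g) =
      g / f * ((1 - δ) * (r' - g)) * ((r - f) / (r - g)) := by ring
    rw [this, h3]
    field_simp
  rw [div_eq_iff hrg', add_mul, h4, h2]
  ring

/-- The second half of the ratio asymptotics: `Pₙ₊₁ / Pₙ → f` uniformly on compact sets off the
real line. -/
theorem HasPositiveRecurrence.tendstoUniformlyOn_consecutiveRatio {P : ℕ → ℂ[X]} {b l : ℕ → ℂ}
    (h : HasPositiveRecurrence P b l) {a c : ℝ} (ha : 0 ≤ a)
    (hb : Filter.Tendsto b Filter.atTop (nhds (c : ℂ)))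
    (hl : Filter.Tendsto l Filter.atTop (nhds (a : ℂ)))
    {K : Set ℂ} (hK : IsCompact K) (hK0 : K ⊆ {z : ℂ | z.im ≠ 0}) :
    TendstoUniformlyOn (consecutiveRatio P) (ratioLimit a c) Filter.atTop K := by
  obtain ⟨m, hm, hmK⟩ := exists_pos_le_abs_im hK hK0
  have hfc := continuousOn_ratioLimit ha c hK0
  set f := ratioLimit a c with hf
  set g : ℂ → ℂ := fun z => z - c - f z with hg
  have hgc : ContinuousOn g K := by fun_prop
  have hf0 : ∀ z ∈ K, f z ≠ 0 := fun z hz => ratioLimit_ne_zero a c (hK0 hz)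
  have hmr : ∀ n, ∀ z ∈ K, m ≤ ‖consecutiveRatio P n z‖ := fun n z hz =>
    (hmK z hz).trans (abs_im_le_norm_of_sq_le (hK0 hz)
      (h.eval_ne_zero_and_sq_im_le n (hK0 hz)).2)
  -- `rₙ` and `g` lie in opposite half-planes, so they stay apart.
  have hmg : ∀ n, ∀ z ∈ K, m ≤ ‖consecutiveRatio P n z - g z‖ := by
    intro n z hz
    refine (hmK z hz).trans (abs_im_le_norm_of_sq_le (hK0 hz) ?_)
    have h1 := (h.eval_ne_zero_and_sq_im_le n (hK0 hz)).2
    have h2 := (lt_normSq_ratioLimit_and_im_mul_nonpos ha c (hK0 hz)).2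
    rw [Complex.sub_im, sub_mul]
    change (g z).im * z.im ≤ 0 at h2
    linarith
  have hr0 : ∀ n, ∀ z ∈ K, consecutiveRatio P n z ≠ 0 := fun n z hz =>
    h.consecutiveRatio_ne_zero n (hK0 hz)
  have hrg0 : ∀ n, ∀ z ∈ K, consecutiveRatio P n z - g z ≠ 0 := fun n z hz =>
    norm_pos_iff.mp (hm.trans_le (hmg n z hz))
  set δ : ℕ → ℂ → ℂ := fun n z =>
    (c - b (n + 2) + (a - l (n + 2)) / consecutiveRatio P n z) /
      (consecutiveRatio P (n + 1) z - g z) with hδ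
  have hδ0 : TendstoUniformlyOn δ (fun _ => 0) Filter.atTop K := by
    rw [Metric.tendstoUniformlyOn_iff]
    intro ε hε
    have hlim : Filter.Tendsto
        (fun n => (‖(c : ℂ) - b (n + 2)‖ + ‖(a : ℂ) - l (n + 2)‖ / m) / m)
        Filter.atTop (nhds 0) := by
      have h1 := ((hb.comp (Filter.tendsto_add_atTop_nat 2)).const_sub (c : ℂ)).norm
      have h2 := ((hl.comp (Filter.tendsto_add_atTop_nat 2)).const_sub (a : ℂ)).norm
      simpa using (h1.add (h2.div_const m)).div_const m
    filter_upwards [hlim.eventually_lt_const hε] with n hn z hz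
    rw [dist_zero_left]
    refine lt_of_le_of_lt ?_ hn
    rw [hδ, norm_div]
    refine div_le_div₀ (by positivity) ?_ hm (hmg (n + 1) z hz)
    refine (norm_add_le _ _).trans (add_le_add_right ?_ _)
    rw [norm_div]
    exact div_le_div_of_nonneg_left (norm_nonneg _) hm (hmr n z hz)
  set u : ℕ → ℂ → ℂ := fun n z =>
    (consecutiveRatio P n z - f z) / (consecutiveRatio P n z - g z) with hu
  have huc : ∀ n, ContinuousOn (u n) K := fun n =>
    ((h.continuousOn_consecutiveRatio n hK0).sub hfc).div
      ((h.continuousOn_consecutiveRatio n hK0).sub hgc) (hrg0 n)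
  have hqc : ContinuousOn (fun z => g z / f z) K := hgc.div hfc hf0
  have hq1 : ∀ z ∈ K, ‖g z / f z‖ < 1 := by
    intro z hz
    have h1 := (lt_normSq_ratioLimit_and_im_mul_nonpos ha c (hK0 hz)).1
    have h2 : g z = a / f z := sub_ratioLimit_eq_div a c (hK0 hz)
    have h3 := norm_pos_iff.mpr (hf0 z hz)
    rw [h2, div_div, norm_div, norm_mul, Complex.norm_real, Real.norm_of_nonneg ha,
      div_lt_one (by positivity), ← pow_two]
    exact h1
  have hu0 : TendstoUniformlyOn u (fun _ => 0) Filter.atTop K := by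
    refine tendstoUniformlyOn_zero_of_recurrence hK (θ := fun n z => g z / f z * (1 - δ n z))
      (θ' := fun z => g z / f z) (η := δ) huc ?_ ?_ hqc hq1 hδ0
    · intro n z hz
      refine mobius_step (hf0 z hz) (hr0 n z hz) (hrg0 n z hz) (hrg0 (n + 1) z hz) ?_
        (ratioLimit_mul_sub_ratioLimit a c (hK0 hz))
        (h.hasRecurrence.consecutiveRatio_succ
          (h.eval_ne_zero_and_sq_im_le (n + 1) (hK0 hz)).1) rfl
      simp [hg]
    · simpa using (tendstoUniformlyOn_const_seq (fun z => g z / f z) K).mul_of_isCompact hK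
        ((tendstoUniformlyOn_const_seq (fun _ => 1) K).fun_sub hδ0) hqc (by fun_prop)
  -- Return from `u` to `r = (f - u g) / (1 - u)`.
  have hug := hu0.mul_of_isCompact hK (tendstoUniformlyOn_const_seq g K) (by fun_prop) hgc
  have hquot := ((tendstoUniformlyOn_const_seq f K).fun_sub hug).div_of_isCompact hK
    ((tendstoUniformlyOn_const_seq (fun _ => 1) K).fun_sub hu0) (by fun_prop) (by fun_prop)
    (by simp)
  refine (hquot.congr_right fun z _ => by simp).congr (Filter.Eventually.of_forall fun n z hz => ?_)
  have hfg : f z - g z ≠ 0 := by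
    intro h0
    have h1 := hq1 z hz
    rw [← sub_eq_zero.mp h0, div_self (hf0 z hz), norm_one] at h1
    exact lt_irrefl _ h1
  have h1 : u n z * (consecutiveRatio P n z - g z) = consecutiveRatio P n z - f z :=
    div_mul_cancel₀ _ (hrg0 n z hz)
  have h2 : 1 - u n z ≠ 0 := by
    intro h0
    rw [← sub_eq_zero.mp h0] at h1
    exact hfg (by linear_combination h1)
  change (f z - u n z * g z) / (1 - u n z) = consecutiveRatio P n z
  rw [div_eq_iff h2]
  linear_combination h1

/-! ### Kernel polynomials -/

section Kernel

variable {P : ℕ → ℂ[X]} {b l : ℕ → ℂ}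

/-- The kernel polynomials satisfy a first-order linear recurrence, without division by `z - κ`. -/
theorem HasPositiveRecurrence.kernelPolynomial_succ (h : HasPositiveRecurrence P b l) {κ : ℂ}
    (hκ : κ.im ≠ 0) (n : ℕ) : kernelPolynomial P κ (n + 1) =
      P (n + 1) + C (l (n + 2) / consecutiveRatio P n κ) * kernelPolynomial P κ n := by
  have h0 := (h.eval_ne_zero_and_sq_im_le n hκ).1
  have h1 := (h.eval_ne_zero_and_sq_im_le (n + 1) hκ).1
  have hr := h.consecutiveRatio_ne_zero n hκ
  have e0 := X_sub_C_mul_kernelPolynomial P κ n h0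
  have e1 := X_sub_C_mul_kernelPolynomial P κ (n + 1) h1
  change _ = _ - C (consecutiveRatio P n κ) * P n at e0
  change _ = P (n + 2) - C (consecutiveRatio P (n + 1) κ) * P (n + 1) at e1
  rw [h.hasRecurrence.consecutiveRatio_succ h1, C_sub, C_sub] at e1
  have e2 : C (l (n + 2) / consecutiveRatio P n κ) * C (consecutiveRatio P n κ) =
      C (l (n + 2)) := by
    rw [← C_mul, div_mul_cancel₀ _ hr]
  refine mul_left_cancel₀ (X_sub_C_ne_zero κ) ?_
  linear_combination e1 - C (l (n + 2) / consecutiveRatio P n κ) * e0 - h.hasRecurrence.2.2 n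
    + P n * e2

/-- The quotient `hₙ(z) = Pₙ*(κ, z) / Pₙ(z)`, which away from `κ` is
`(rₙ(z) - rₙ(κ)) / (z - κ)`. -/
noncomputable def kernelQuotient (P : ℕ → ℂ[X]) (κ : ℂ) (n : ℕ) (z : ℂ) : ℂ :=
  (kernelPolynomial P κ n).eval z / (P n).eval z

theorem HasPositiveRecurrence.kernelQuotient_succ (h : HasPositiveRecurrence P b l) {κ : ℂ}
    (hκ : κ.im ≠ 0) (n : ℕ) {z : ℂ} (hz : z.im ≠ 0) : kernelQuotient P κ (n + 1) z =
      l (n + 2) / (consecutiveRatio P n z * consecutiveRatio P n κ) * kernelQuotient P κ n z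
        + 1 := by
  have h0 := (h.eval_ne_zero_and_sq_im_le n hz).1
  have h1 := (h.eval_ne_zero_and_sq_im_le (n + 1) hz).1
  have hr := h.consecutiveRatio_ne_zero n hκ
  rw [kernelQuotient, h.kernelPolynomial_succ hκ, kernelQuotient]
  rw [show consecutiveRatio P n z = (P (n + 1)).eval z / (P n).eval z from rfl]
  simp only [eval_add, eval_mul, eval_C]
  field_simp
  ring

theorem norm_div_ratioLimit_mul_lt_one {a : ℝ} (ha : 0 ≤ a) (c : ℝ) {z κ : ℂ} (hz : z.im ≠ 0)
    (hκ : κ.im ≠ 0) : ‖a / (ratioLimit a c z * ratioLimit a c κ)‖ < 1 := by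
  have h1 := (lt_normSq_ratioLimit_and_im_mul_nonpos ha c hz).1
  have h2 := (lt_normSq_ratioLimit_and_im_mul_nonpos ha c hκ).1
  rw [norm_div, Complex.norm_real, Real.norm_of_nonneg ha,
    div_lt_one (norm_pos_iff.mpr (mul_ne_zero (ratioLimit_ne_zero a c hz)
      (ratioLimit_ne_zero a c hκ))), norm_mul]
  refine lt_of_pow_lt_pow_left₀ 2 (by positivity) ?_
  rw [mul_pow, pow_two]
  exact mul_lt_mul'' h1 h2 ha ha

theorem continuousOn_div_ratioLimit_mul {a : ℝ} (ha : 0 ≤ a) (c : ℝ) {κ : ℂ} (hκ : κ.im ≠ 0)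
    {K : Set ℂ} (hK : K ⊆ {z : ℂ | z.im ≠ 0}) :
    ContinuousOn (fun z => a / (ratioLimit a c z * ratioLimit a c κ)) K :=
  continuousOn_const.div ((continuousOn_ratioLimit ha c hK).mul continuousOn_const)
    fun _ hz => mul_ne_zero (ratioLimit_ne_zero a c (hK hz)) (ratioLimit_ne_zero a c hκ)

theorem one_sub_ne_zero_of_norm_lt_one {w : ℂ} (hw : ‖w‖ < 1) : 1 - w ≠ 0 := by
  intro h
  rw [← sub_eq_zero.mp h, norm_one] at hw
  exact lt_irrefl _ hw

/-- `hₙ → 1 / (1 - a / (f(z) f(κ)))` uniformly on compact sets: the limit is the fixed point of the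
limiting recurrence `h ↦ 1 + a h / (f(z) f(κ))`, a contraction because `|f|² > a`. -/
theorem HasPositiveRecurrence.tendstoUniformlyOn_kernelQuotient (h : HasPositiveRecurrence P b l)
    {a c : ℝ} (ha : 0 ≤ a) (hb : Filter.Tendsto b Filter.atTop (nhds (c : ℂ)))
    (hl : Filter.Tendsto l Filter.atTop (nhds (a : ℂ))) {κ : ℂ} (hκ : κ.im ≠ 0)
    {K : Set ℂ} (hK : IsCompact K) (hK0 : K ⊆ {z : ℂ | z.im ≠ 0}) :
    TendstoUniformlyOn (kernelQuotient P κ)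
      (fun z => (1 - a / (ratioLimit a c z * ratioLimit a c κ))⁻¹) Filter.atTop K := by
  have hfc := continuousOn_ratioLimit ha c hK0
  have hr := h.tendstoUniformlyOn_consecutiveRatio ha hb hl hK hK0
  have hrκ : Filter.Tendsto (fun n => consecutiveRatio P n κ) Filter.atTop
      (nhds (ratioLimit a c κ)) :=
    (h.tendstoUniformlyOn_consecutiveRatio ha hb hl (isCompact_singleton (x := κ))
      (by simpa using hκ)).tendsto_at rfl
  have hfκ : ratioLimit a c κ ≠ 0 := ratioLimit_ne_zero a c hκ
  have hf0 : ∀ z ∈ K, ratioLimit a c z ≠ 0 := fun z hz => ratioLimit_ne_zero a c (hK0 hz)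
  set θ' : ℂ → ℂ := fun z => a / (ratioLimit a c z * ratioLimit a c κ)
  have hden : ∀ z ∈ K, ratioLimit a c z * ratioLimit a c κ ≠ 0 := fun z hz =>
    mul_ne_zero (hf0 z hz) hfκ
  have hθc : ContinuousOn θ' K := continuousOn_div_ratioLimit_mul ha c hκ hK0
  have hθ1 : ∀ z ∈ K, ‖θ' z‖ < 1 := fun z hz => norm_div_ratioLimit_mul_lt_one ha c (hK0 hz) hκ
  have hne : ∀ z ∈ K, 1 - θ' z ≠ 0 := fun z hz => one_sub_ne_zero_of_norm_lt_one (hθ1 z hz)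
  have hHc : ContinuousOn (fun z => (1 - θ' z)⁻¹) K := (continuousOn_const.sub hθc).inv₀ hne
  have hθ : TendstoUniformlyOn
      (fun n z => l (n + 2) / (consecutiveRatio P n z * consecutiveRatio P n κ)) θ'
      Filter.atTop K :=
    ((hl.comp (Filter.tendsto_add_atTop_nat 2)).tendstoUniformlyOn_const K).div_of_isCompact hK
      (hr.mul_of_isCompact hK (hrκ.tendstoUniformlyOn_const K) hfc continuousOn_const)
      continuousOn_const (hfc.mul continuousOn_const) hden
  have hη : TendstoUniformlyOn (fun n z =>
      (l (n + 2) / (consecutiveRatio P n z * consecutiveRatio P n κ) - θ' z) * (1 - θ' z)⁻¹)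
      (fun _ => 0) Filter.atTop K := by
    simpa using (hθ.fun_sub (tendstoUniformlyOn_const_seq θ' K)).mul_of_isCompact hK
      (tendstoUniformlyOn_const_seq (fun z => (1 - θ' z)⁻¹) K) (by fun_prop) hHc
  have he := tendstoUniformlyOn_zero_of_recurrence hK
    (e := fun n z => kernelQuotient P κ n z - (1 - θ' z)⁻¹) (fun n => ContinuousOn.sub
      ((kernelPolynomial P κ n).continuous.continuousOn.div (P n).continuous.continuousOn
        fun z hz => (h.eval_ne_zero_and_sq_im_le n (hK0 hz)).1) hHc) ?_ hθ hθc hθ1 hη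
  · simpa using he.fun_add (tendstoUniformlyOn_const_seq (fun z => (1 - θ' z)⁻¹) K)
  · intro n z hz
    rw [h.kernelQuotient_succ hκ n (hK0 hz)]
    have := mul_inv_cancel₀ (hne z hz)
    linear_combination -this

end Kernel

/-- Ratio asymptotics of the kernel polynomials of an orthogonal polynomial system in a Nevai
class. The first conjunct and the first half of the second one say that all the quotients make
sense. -/
theorem mainTheorem5 (L : Polynomial ℂ →ₗ[ℂ] ℂ) (hL : IsPositiveDefinite L)
    (P : ℕ → Polynomial ℂ) (hP : IsMonicOPS L P) (a c : ℝ) (hN : InNevaiClass P a c)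
    (κ : ℂ) (hκ : κ.im ≠ 0) :
    (∀ n : ℕ, ∀ z : ℂ, z.im ≠ 0 → (P n).eval z ≠ 0) ∧
    ∀ K : Set ℂ, IsCompact K → K ⊆ {z : ℂ | z.im ≠ 0} →
      (∀ᶠ n : ℕ in Filter.atTop, ∀ z ∈ K, (kernelPolynomial P κ n).eval z ≠ 0) ∧
      TendstoUniformlyOn
        (fun (n : ℕ) (z : ℂ) =>
          (kernelPolynomial P κ (n + 1)).eval z / (kernelPolynomial P κ n).eval z)
        (ratioLimit a c) Filter.atTop K ∧
      TendstoUniformlyOn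
        (fun (n : ℕ) (z : ℂ) => (P (n + 1)).eval z / (P n).eval z)
        (ratioLimit a c) Filter.atTop K := by
  obtain ⟨ha, b, l, hR, hb, hl⟩ := hN
  have h := hR.hasPositiveRecurrence hL hP
  refine ⟨fun n z hz => (h.eval_ne_zero_and_sq_im_le n hz).1, fun K hK hK0 => ?_⟩
  have hr := h.tendstoUniformlyOn_consecutiveRatio ha hb hl hK hK0
  have hfc := continuousOn_ratioLimit ha c hK0
  have hq := h.tendstoUniformlyOn_kernelQuotient ha hb hl hκ hK hK0
  set θ' : ℂ → ℂ := fun z => a / (ratioLimit a c z * ratioLimit a c κ)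
  have hθc : ContinuousOn θ' K := continuousOn_div_ratioLimit_mul ha c hκ hK0
  have hθ1 : ∀ z ∈ K, ‖θ' z‖ < 1 := fun z hz => norm_div_ratioLimit_mul_lt_one ha c (hK0 hz) hκ
  have hne : ∀ z ∈ K, 1 - θ' z ≠ 0 := fun z hz => one_sub_ne_zero_of_norm_lt_one (hθ1 z hz)
  have hHc : ContinuousOn (fun z => (1 - θ' z)⁻¹) K := (continuousOn_const.sub hθc).inv₀ hne
  have hq0 : ∀ᶠ n : ℕ in Filter.atTop, ∀ z ∈ K, (kernelPolynomial P κ n).eval z ≠ 0 := by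
    -- `hₙ` is eventually within `1/4` of its limit, which has modulus at least `1/2`.
    filter_upwards [Metric.tendstoUniformlyOn_iff.mp hq (1 / 4) (by norm_num)] with n hn z hz h0
    have h1 := hn z hz
    rw [kernelQuotient, h0, zero_div, dist_zero_right, norm_inv] at h1
    have h2 : ‖1 - θ' z‖ < 2 := by
      have h3 := norm_sub_le (1 : ℂ) (θ' z)
      rw [norm_one] at h3
      linarith [hθ1 z hz]
    have h4 := one_div_lt_one_div_of_lt (norm_pos_iff.mpr (hne z hz)) h2
    rw [one_div ‖_‖] at h4
    change ‖1 - θ' z‖⁻¹ < _ at h1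
    linarith
  refine ⟨hq0, ?_, hr⟩
  have hq1 : TendstoUniformlyOn (fun n => kernelQuotient P κ (n + 1)) (fun z => (1 - θ' z)⁻¹)
      Filter.atTop K := fun u hu => (Filter.tendsto_add_atTop_nat 1).eventually (hq u hu)
  have hlim := hr.mul_of_isCompact hK (hq1.div_of_isCompact hK hq hHc hHc
    fun z hz => inv_ne_zero (hne z hz)) hfc
    (hHc.div hHc fun z hz => inv_ne_zero (hne z hz))
  refine (hlim.congr_right fun z hz => ?_).congr ?_
  · change ratioLimit a c z * ((1 - θ' z)⁻¹ / (1 - θ' z)⁻¹) = _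
    rw [div_self (inv_ne_zero (hne z hz)), mul_one]
  · filter_upwards [hq0] with n hn z hz
    have h0 := (h.eval_ne_zero_and_sq_im_le n (hK0 hz)).1
    have h1 := (h.eval_ne_zero_and_sq_im_le (n + 1) (hK0 hz)).1
    have h2 := hn z hz
    simp only [consecutiveRatio, kernelQuotient]
    field_simp
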